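/- Let $\mathbb{D}$ be the open unit disc, $\overline{\mathbb{D}}$ the closed unit disc and $\mathbb{T}$ the unit circle in $\mathbb{C}$. A holomorphic function $f$ on $\mathbb{D}$ is called *Abel universal* if for every compact set $K\subset\mathbb{T}$ with $K\neq\mathbb{T}$ and every continuous function $\varphi:K\to\mathbb{C}$ there is a sequence $(r_n)$ in $[0,1)$ with $r_n\to 1$ such that $\sup_{\zeta\in K}|f(r_n\zeta)-\varphi(\zeta)|\to 0$ as $n\to\infty$. For $f(z)=\sum_{k\ge 0}a_kz^k$ holomorphic on $\mathbb{D}$, let $S_n(f)(z)=\sum_{k=0}^{n}a_kz^k$, $z\in\mathbb{C}$, be the $n$-th partial sum of its Taylor expansion at $0$. There exists an Abel universal function $f$ such that $|S_n(f)(z)|\to\infty$ as $n\to\infty$ for almost every $z\in\mathbb{C}\setminus\overline{\mathbb{D}}$ with respect to two-dimensional Lebesgue measure, and $|S_n(f)(z)|\to\infty$ as $n\to\infty$ for almost every $z\in\mathbb{T}$ with respect to arclength measure. -/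

import Mathlib

open Filter MeasureTheory Metric Set
open scoped Topology

/-- Abel universal functions on the open unit disc. Only the values of `f` on the disc matter. -/
structure IsAbelUniversal (f : ℂ → ℂ) : Prop where
  holo : DifferentiableOn ℂ f (ball 0 1)
  universal : ∀ K : Set ℂ, IsCompact K → K ⊆ sphere 0 1 → K ≠ sphere 0 1 →
    ∀ g : ℂ → ℂ, ContinuousOn g K →
      ∃ r : ℕ → ℝ, (∀ n, r n ∈ Ico (0 : ℝ) 1) ∧ Tendsto r atTop (𝓝 1) ∧
        TendstoUniformlyOn (fun n z => f ((r n : ℂ) * z)) g atTop K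

/-- The `n`-th partial sum `∑_{k=0}^n a_k z^k` of the Taylor expansion of `f` at `0`. -/
noncomputable def taylorPartialSum (f : ℂ → ℂ) (n : ℕ) (z : ℂ) : ℂ :=
  ∑ k ∈ Finset.range (n + 1), (iteratedDeriv k f 0 / (k.factorial : ℂ)) * z ^ k

/-- Arclength measure on the unit circle, as a measure on `ℂ` carried by the circle: the image of
Lebesgue measure on `(0, 2π]` under `θ ↦ exp (i θ)`. -/
noncomputable def arclengthMeasure : Measure ℂ :=
  (volume.restrict (Ioc (0 : ℝ) (2 * Real.pi))).map (fun θ : ℝ => Complex.exp (θ * Complex.I))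

/-! The function is a limit of polynomials `F j`, with cutoffs `N j` below which coefficients are
final. Stage `j` adds two corrections with no coefficient below `N j`. The first is small on a disc
and brings the polynomial close to a prescribed function on an arc of a larger circle; running
through countably many arcs and functions gives Abel universality
(`exists_polynomial_near_zero_and_near`). The second makes partial sums large. Off the unit disc,
the sums obtained by adding `t * (2 * n + 1) * z ^ n`, for distinct integers `t`, cannot both have
norm at most `n` at one point. Among `(n + 1) ^ 2` choices of `t`, one is thus bad only on a set of
measure at most `μ univ / (n + 1) ^ 2` (`exists_translate_measure_le`), and Borel–Cantelli applies.
The coefficients used grow at most cubically, so the second correction is negligible on a disc of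
radius below 1 once `N j` is large (`exists_slowTailLE`). -/

/-! ### Polynomial approximation via spectra in `polyClosure` -/

open Polynomial in
/-- The closure in `C(L, ℂ)` of the algebra of polynomial functions. -/
noncomputable abbrev polyClosure (L : Set ℂ) [CompactSpace L] : Subalgebra ℂ C(L, ℂ) :=
  Algebra.elemental ℂ ((X : ℂ[X]).toContinuousMapOn L)

/-- The identity function of `L`, as an element of `polyClosure L`. -/
noncomputable def polyClosure.id (L : Set ℂ) [CompactSpace L] : polyClosure L :=
  ⟨_, Algebra.elemental.self_mem ℂ _⟩

theorem polyClosure.id_apply (L : Set ℂ) [CompactSpace L] (z : L) :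
    (polyClosure.id L : C(L, ℂ)) z = z := by
  simp [polyClosure.id]

theorem exists_polynomial_of_mem_polyClosure {L : Set ℂ} [CompactSpace L] {f : C(L, ℂ)}
    (hf : f ∈ polyClosure L) {ε : ℝ} (hε : 0 < ε) :
    ∃ p : Polynomial ℂ, ∀ z : L, ‖p.eval (z : ℂ) - f z‖ < ε := by
  have h1 : f ∈ closure ((polynomialFunctions L : Subalgebra ℂ C(L, ℂ)) : Set C(L, ℂ)) := by
    rw [polynomialFunctions.eq_adjoin_X]
    exact hf
  obtain ⟨g, hg, hfg⟩ := Metric.mem_closure_iff.1 h1 ε hε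
  rw [polynomialFunctions_coe] at hg
  obtain ⟨p, rfl⟩ := hg
  refine ⟨p, fun z => ?_⟩
  have := (ContinuousMap.dist_lt_iff hε).1 hfg z
  rw [dist_comm, dist_eq_norm] at this
  simpa using this

/-- Passing from `C(L, ℂ)` to a closed subalgebra can only fill bounded components of the complement
of the spectrum, which here is `L`. This replaces Runge's pole pushing. -/
theorem notMem_spectrum_polyClosure_id {L : Set ℂ} [CompactSpace L] {w : ℂ} {S : Set ℂ}
    (hS : IsPreconnected S) (hw : w ∈ S) (hSL : S ⊆ Lᶜ) (hSb : ¬ Bornology.IsBounded S) :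
    w ∉ spectrum ℂ (polyClosure.id L) := by
  intro h
  have h1 := Subalgebra.spectrum_isBounded_connectedComponentIn (polyClosure L)
    (polyClosure.id L) h
  have h2 : spectrum ℂ (polyClosure.id L : C(L, ℂ)) = L := by
    rw [ContinuousMap.spectrum_eq_range]
    ext z
    simp [polyClosure.id_apply]
  rw [h2] at h1
  exact hSb (h1.subset (hS.subset_connectedComponentIn hw hSL))

/-- The ray from `w` away from the origin. -/
theorem ray_unbounded {w : ℂ} (hw : w ≠ 0) :
    IsPreconnected ((fun t : ℝ => (t : ℂ) * w) '' Ici 1) ∧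
      w ∈ (fun t : ℝ => (t : ℂ) * w) '' Ici 1 ∧
      ¬ Bornology.IsBounded ((fun t : ℝ => (t : ℂ) * w) '' Ici 1) := by
  refine ⟨isPreconnected_Ici.image _ (by fun_prop), ⟨1, by simp, by simp⟩, fun h => ?_⟩
  obtain ⟨R, hR⟩ := h.exists_norm_le
  have hw' : 0 < ‖w‖ := norm_pos_iff.2 hw
  have h1 := hR _ (mem_image_of_mem (fun t : ℝ => (t : ℂ) * w)
    (mem_Ici.2 (le_max_left 1 ((R + 1) / ‖w‖))))
  rw [norm_mul, Complex.norm_real, Real.norm_of_nonneg (by positivity)] at h1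
  have h2 := mul_le_mul_of_nonneg_right (le_max_right 1 ((R + 1) / ‖w‖)) hw'.le
  rw [div_mul_cancel₀ _ hw'.ne'] at h2
  linarith

/-- If `L` is the union of a disc and a proper subset of a larger circle, then the points
outside `L` lie off the spectrum of the identity function. -/
theorem notMem_spectrum_of_disc_union_arc {L : Set ℂ} [CompactSpace L] {ρ r : ℝ}
    (hr : 0 < r) {ζ : ℂ} (hζ : ζ ∈ sphere (0 : ℂ) r) (hζL : ζ ∉ L)
    (hL : L ⊆ closedBall 0 ρ ∪ sphere 0 r) {w : ℂ} (hwr : ‖w‖ ≠ r) (hwρ : ρ < ‖w‖)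
    (hw0 : w ≠ 0) :
    w ∉ spectrum ℂ (polyClosure.id L) := by
  have hw' : 0 < ‖w‖ := norm_pos_iff.2 hw0
  have hζr : ‖ζ‖ = r := by simpa using hζ
  set v : ℂ := ((‖w‖ / r : ℝ) : ℂ) * ζ with hv
  have hvw : ‖v‖ = ‖w‖ := by
    rw [hv, norm_mul, Complex.norm_real, Real.norm_of_nonneg (by positivity), hζr]
    field_simp
  have hv0 : v ≠ 0 := norm_pos_iff.1 (by rw [hvw]; exact hw')
  obtain ⟨h1, h2, h3⟩ := ray_unbounded hv0
  refine notMem_spectrum_polyClosure_id (S := sphere 0 ‖w‖ ∪ _)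
    ((isPreconnected_sphere (by simp) 0 ‖w‖).union v (by simpa using hvw) h2 h1)
    (Or.inl (by simp)) ?_ (fun h => h3 (h.subset subset_union_right))
  rintro z (hz | ⟨t, ht, rfl⟩) hzL
  · have hz' : ‖z‖ = ‖w‖ := by simpa using hz
    rcases hL hzL with h | h
    · rw [mem_closedBall_zero_iff] at h
      linarith
    · rw [mem_sphere_zero_iff_norm] at h
      exact hwr (hz'.symm.trans h)
  · have ht' : (1 : ℝ) ≤ t := ht
    have hn : ‖(t : ℂ) * v‖ = t * ‖w‖ := by
      rw [norm_mul, Complex.norm_real, Real.norm_of_nonneg (by linarith), hvw]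
    rcases hL hzL with h | h
    · rw [mem_closedBall_zero_iff, hn] at h
      nlinarith
    · rw [mem_sphere_zero_iff_norm, hn] at h
      apply hζL
      have : (t : ℂ) * v = ζ := by
        rw [hv, ← mul_assoc, ← Complex.ofReal_mul]
        have : t * (‖w‖ / r) = 1 := by field_simp; exact h
        rw [this]; simp
      simpa [this] using hzL

/-- For `ρ < s < r` and large `m`, the function `z ^ m / (z ^ m - s ^ m)` is near 0 on the disc and
near 1 on the circle. It lies in `polyClosure L` because its poles, on the circle of radius `s`, can
escape to infinity through the gap at `ζ`. -/
theorem exists_polynomial_near_indicator {K : Set ℂ} {ρ r : ℝ} (hρ : 0 ≤ ρ) (hρr : ρ < r)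
    (hK : IsCompact K) (hKs : K ⊆ sphere 0 r) (hKne : K ≠ sphere 0 r) {ε : ℝ} (hε : 0 < ε) :
    ∃ p : Polynomial ℂ, (∀ z ∈ closedBall (0 : ℂ) ρ, ‖p.eval z‖ ≤ ε) ∧
      ∀ z ∈ K, ‖p.eval z - 1‖ ≤ ε := by
  obtain ⟨ζ, hζ, hζK⟩ : ∃ ζ ∈ sphere (0 : ℂ) r, ζ ∉ K := by
    by_contra! h
    exact hKne (hKs.antisymm h)
  have hr : 0 < r := hρ.trans_lt hρr
  have hζr : ‖ζ‖ = r := by simpa using hζ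
  set L : Set ℂ := closedBall 0 ρ ∪ K with hLdef
  have hLc : IsCompact L := (isCompact_closedBall _ _).union hK
  have : CompactSpace L := isCompact_iff_compactSpace.1 hLc
  obtain ⟨s, hρs, hsr⟩ := exists_between hρr
  have hs : 0 < s := hρ.trans_lt hρs
  have hζL : ζ ∉ L := by
    rintro (h | h)
    · rw [mem_closedBall_zero_iff] at h; linarith
    · exact hζK h
  have hLsub : L ⊆ closedBall 0 ρ ∪ sphere 0 r := union_subset_union_right _ hKs
  -- choose the exponent
  have hlim1 : Tendsto (fun m : ℕ => (ρ / s) ^ m) atTop (𝓝 0) :=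
    tendsto_pow_atTop_nhds_zero_of_lt_one (by positivity) ((div_lt_one hs).2 hρs)
  have hlim2 : Tendsto (fun m : ℕ => (s / r) ^ m) atTop (𝓝 0) :=
    tendsto_pow_atTop_nhds_zero_of_lt_one (by positivity) ((div_lt_one hr).2 hsr)
  set δ : ℝ := min (1 / 2) (ε / 4) with hδ
  have hδ0 : 0 < δ := by positivity
  have hδ1 : δ ≤ 1 / 2 := min_le_left _ _
  have hδ2 : δ ≤ ε / 4 := min_le_right _ _
  obtain ⟨m, hm0, hm1, hm2⟩ := ((eventually_gt_atTop 0).and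
    ((hlim1.eventually_lt_const hδ0).and (hlim2.eventually_lt_const hδ0))).exists
  have hunit : ((s : ℂ) ^ m) ∉ spectrum ℂ (polyClosure.id L ^ m) := by
    rw [spectrum.map_pow_of_pos _ hm0]
    rintro ⟨w, hw, hwm⟩
    have hwn : ‖w‖ = s := by
      have := congrArg norm hwm
      simp only [norm_pow, Complex.norm_real, Real.norm_of_nonneg hs.le] at this
      exact (pow_left_inj₀ (norm_nonneg _) hs.le hm0.ne').1 this
    refine notMem_spectrum_of_disc_union_arc hr hζ hζL hLsub ?_ ?_ ?_ hw
    · rw [hwn]; exact hsr.ne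
    · rw [hwn]; exact hρs
    · exact norm_pos_iff.1 (by rw [hwn]; exact hs)
  rw [spectrum.notMem_iff] at hunit
  obtain ⟨u, hu⟩ := hunit
  have hval : ∀ z : L, ((s : ℂ) ^ m - (z : ℂ) ^ m) * ((↑u⁻¹ : polyClosure L) : C(L, ℂ)) z = 1 := by
    intro z
    have h1 := congrArg (fun a : polyClosure L => (a : C(L, ℂ)) z) (Units.mul_inv u)
    simp only [hu] at h1
    simpa [polyClosure.id_apply, Algebra.algebraMap_eq_smul_one] using h1
  set g : polyClosure L := 1 - (algebraMap ℂ (polyClosure L) ((s : ℂ) ^ m)) * (↑u⁻¹) with hg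
  have hgval : ∀ z : L, (g : C(L, ℂ)) z =
      1 - (s : ℂ) ^ m * ((↑u⁻¹ : polyClosure L) : C(L, ℂ)) z := by
    intro z
    simp [hg, Algebra.algebraMap_eq_smul_one]
  obtain ⟨p, hp⟩ := exists_polynomial_of_mem_polyClosure g.2 (half_pos hε)
  have hsm : ((s : ℂ) ^ m) ≠ 0 := pow_ne_zero _ (by exact_mod_cast hs.ne')
  refine ⟨p, fun z hz => ?_, fun z hz => ?_⟩
  · have hzL : z ∈ L := Or.inl hz
    have hp' := hp ⟨z, hzL⟩
    have h1 := hval ⟨z, hzL⟩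
    have h2 := hgval ⟨z, hzL⟩
    set v := ((↑u⁻¹ : polyClosure L) : C(L, ℂ)) ⟨z, hzL⟩
    simp only at h1 h2 hp'
    set q : ℂ := (z / s) ^ m with hq
    have hq1 : ‖q‖ ≤ δ := by
      rw [hq, norm_pow, norm_div, Complex.norm_real, Real.norm_of_nonneg hs.le]
      rw [mem_closedBall_zero_iff] at hz
      exact (pow_le_pow_left₀ (by positivity) (by gcongr) m).trans hm1.le
    have hzq : z ^ m = s ^ m * q := by
      rw [hq, div_pow]; field_simp
    have h3 : (1 - q) * (g : C(L, ℂ)) ⟨z, hzL⟩ = -q := by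
      rw [h2]
      have : (1 - q) * ((s : ℂ) ^ m * v) = 1 := by linear_combination h1 + v * hzq
      linear_combination -this
    have h4 : (1 / 2 : ℝ) ≤ ‖1 - q‖ := by
      have := norm_sub_norm_le (1 : ℂ) q
      rw [norm_one] at this
      linarith
    have h5 : ‖(g : C(L, ℂ)) ⟨z, hzL⟩‖ ≤ ε / 2 := by
      have h6 := congrArg norm h3
      rw [norm_mul, norm_neg] at h6
      have := mul_le_mul_of_nonneg_right h4 (norm_nonneg ((g : C(L, ℂ)) ⟨z, hzL⟩))
      linarith
    have := norm_add_le (p.eval z - (g : C(L, ℂ)) ⟨z, hzL⟩) ((g : C(L, ℂ)) ⟨z, hzL⟩)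
    rw [sub_add_cancel] at this
    linarith
  · have hzL : z ∈ L := Or.inr hz
    have hp' := hp ⟨z, hzL⟩
    have h1 := hval ⟨z, hzL⟩
    have h2 := hgval ⟨z, hzL⟩
    set v := ((↑u⁻¹ : polyClosure L) : C(L, ℂ)) ⟨z, hzL⟩
    simp only at h1 h2 hp'
    have hzr : ‖z‖ = r := by simpa using hKs hz
    have hz0 : z ≠ 0 := norm_pos_iff.1 (by rw [hzr]; exact hr)
    set q : ℂ := (s / z) ^ m with hq
    have hq1 : ‖q‖ ≤ δ := by
      rw [hq, norm_pow, norm_div, Complex.norm_real, Real.norm_of_nonneg hs.le, hzr]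
      exact hm2.le
    have hzq : (s : ℂ) ^ m = z ^ m * q := by
      rw [hq, div_pow]; field_simp
    have h3 : (q - 1) * ((g : C(L, ℂ)) ⟨z, hzL⟩ - 1) = -q := by
      rw [h2]
      have : (q - 1) * (z ^ m * v) = 1 := by linear_combination h1 - v * hzq
      rw [hzq]
      linear_combination -q * this
    have h4 : (1 / 2 : ℝ) ≤ ‖q - 1‖ := by
      have := norm_sub_norm_le (1 : ℂ) q
      rw [norm_one, norm_sub_rev] at this
      linarith
    have h5 : ‖(g : C(L, ℂ)) ⟨z, hzL⟩ - 1‖ ≤ ε / 2 := by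
      have h6 := congrArg norm h3
      rw [norm_mul, norm_neg] at h6
      have := mul_le_mul_of_nonneg_right h4 (norm_nonneg ((g : C(L, ℂ)) ⟨z, hzL⟩ - 1))
      linarith
    have := norm_add_le (p.eval z - (g : C(L, ℂ)) ⟨z, hzL⟩) ((g : C(L, ℂ)) ⟨z, hzL⟩ - 1)
    rw [sub_add_sub_cancel] at this
    linarith

/-- Polynomials are dense in the continuous functions on a proper compact subset of a circle. -/
theorem exists_polynomial_near_on_arc {K : Set ℂ} {r : ℝ} (hr : 0 < r)
    (hK : IsCompact K) (hKs : K ⊆ sphere 0 r) (hKne : K ≠ sphere 0 r) {g : ℂ → ℂ}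
    (hg : ContinuousOn g K) {ε : ℝ} (hε : 0 < ε) :
    ∃ p : Polynomial ℂ, ∀ z ∈ K, ‖p.eval z - g z‖ ≤ ε := by
  obtain ⟨ζ, hζ, hζK⟩ : ∃ ζ ∈ sphere (0 : ℂ) r, ζ ∉ K := by
    by_contra! h
    exact hKne (hKs.antisymm h)
  have hζr : ‖ζ‖ = r := by simpa using hζ
  have : CompactSpace K := isCompact_iff_compactSpace.1 hK
  -- The half-line from 0 through the missing point `ζ` avoids `K`, so `1 / z` is a limit of
  -- polynomials.
  have h0 : (0 : ℂ) ∉ spectrum ℂ (polyClosure.id K) := by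
    obtain ⟨h1, h2, h3⟩ := ray_unbounded (w := ζ) (norm_pos_iff.1 (by rw [hζr]; exact hr))
    refine notMem_spectrum_polyClosure_id (S := segment ℝ 0 ζ ∪ _)
      ((convex_segment (0 : ℂ) ζ).isPreconnected.union ζ (right_mem_segment ℝ _ _) h2 h1)
      (Or.inl (left_mem_segment ℝ _ _)) ?_ (fun h => h3 (h.subset subset_union_right))
    have key : ∀ t : ℝ, 0 ≤ t → (t : ℂ) * ζ ∉ K := by
      intro t ht h
      have h' := hKs h
      rw [mem_sphere_zero_iff_norm, norm_mul, Complex.norm_real, Real.norm_of_nonneg ht, hζr] at h'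
      have : t = 1 := by
        have : t * r = 1 * r := by linarith
        exact mul_right_cancel₀ hr.ne' this
      rw [this] at h
      exact hζK (by simpa using h)
    rintro z (hz | ⟨t, ht, rfl⟩)
    · rw [segment_eq_image] at hz
      obtain ⟨t, ht, rfl⟩ := hz
      simpa using key t ht.1
    · exact key t (zero_le_one.trans ht)
  rw [spectrum.zero_notMem_iff] at h0
  obtain ⟨u, hu⟩ := h0
  have hval : ∀ z : K, (z : ℂ) * ((↑u⁻¹ : polyClosure K) : C(K, ℂ)) z = 1 := by
    intro z
    have h1 := congrArg (fun a : polyClosure K => (a : C(K, ℂ)) z) (Units.mul_inv u)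
    simp only [hu] at h1
    simpa [polyClosure.id_apply] using h1
  -- On the circle the conjugate of `z` is `r ^ 2 / z`, so Stone–Weierstrass applies to `polyClosure
  -- K`.
  have hstar : star ((polyClosure.id K : polyClosure K) : C(K, ℂ)) ∈ polyClosure K := by
    have : star ((polyClosure.id K : polyClosure K) : C(K, ℂ)) =
        ((((r ^ 2 : ℝ) : ℂ) • (↑u⁻¹ : polyClosure K) : polyClosure K) : C(K, ℂ)) := by
      ext z
      have hz : ‖(z : ℂ)‖ = r := by simpa using hKs z.2
      have h2 := hval z
      have hz0 : (z : ℂ) ≠ 0 := norm_pos_iff.1 (by rw [hz]; exact hr)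
      simp only [ContinuousMap.star_apply, polyClosure.id_apply, SetLike.val_smul,
        ContinuousMap.smul_apply, smul_eq_mul]
      apply mul_left_cancel₀ hz0
      have h3 := Complex.mul_conj' (z : ℂ)
      rw [hz] at h3
      rw [mul_left_comm, h2]
      simpa using h3
    rw [this]
    exact SetLike.coe_mem _
  have htop : (⟨K.domRestrict g, hg.domRestrict⟩ : C(K, ℂ)) ∈ polyClosure K := by
    have h1 : (⟨K.domRestrict g, hg.domRestrict⟩ : C(K, ℂ)) ∈
        (polynomialFunctions K).starClosure.topologicalClosure := by
      rw [polynomialFunctions.starClosure_topologicalClosure]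
      exact StarSubalgebra.mem_top
    have h2 : ((polynomialFunctions K).starClosure : Set C(K, ℂ)) ⊆ polyClosure K := by
      rw [polynomialFunctions.starClosure_eq_adjoin_X]
      rw [← StarSubalgebra.coe_toSubalgebra, StarAlgebra.adjoin_toSubalgebra]
      refine SetLike.coe_subset_coe.2 (Algebra.adjoin_le ?_)
      rintro f (hf | hf)
      · rw [mem_singleton_iff.1 hf]
        exact Algebra.elemental.self_mem ℂ _
      · rw [star_singleton, mem_singleton_iff] at hf
        rw [hf]
        exact hstar
    exact closure_minimal h2 (Algebra.elemental.isClosed ℂ _) h1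
  obtain ⟨p, hp⟩ := exists_polynomial_of_mem_polyClosure htop hε
  exact ⟨p, fun z hz => (hp ⟨z, hz⟩).le⟩

/-- Simultaneous approximation of `0` on a disc and of a continuous function on a proper compact
subset of a larger circle, by polynomials vanishing to a prescribed order at the origin. -/
theorem exists_polynomial_near_zero_and_near {K : Set ℂ} {ρ r : ℝ} (hρ : 0 ≤ ρ) (hρr : ρ < r)
    (hr1 : r ≤ 1) (hK : IsCompact K) (hKs : K ⊆ sphere 0 r) (hKne : K ≠ sphere 0 r) {g : ℂ → ℂ}
    (hg : ContinuousOn g K) (N : ℕ) {ε : ℝ} (hε : 0 < ε) :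
    ∃ p : Polynomial ℂ, (∀ k < N, p.coeff k = 0) ∧
      (∀ z ∈ closedBall (0 : ℂ) ρ, ‖p.eval z‖ ≤ ε) ∧ ∀ z ∈ K, ‖p.eval z - g z‖ ≤ ε := by
  have hr : 0 < r := hρ.trans_lt hρr
  have hnorm : ∀ z ∈ K, ‖z‖ = r := fun z hz => by simpa using hKs hz
  have hne : ∀ z ∈ K, z ≠ 0 := fun z hz => norm_pos_iff.1 (by rw [hnorm z hz]; exact hr)
  -- Dividing by `z ^ N` first lets the final factor `X ^ N` create the zero at the origin; it does
  -- not enlarge errors since `r ≤ 1`.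
  obtain ⟨q, hq⟩ := exists_polynomial_near_on_arc hr hK hKs hKne (g := fun z => g z / z ^ N)
    (hg.div (by fun_prop) fun z hz => pow_ne_zero _ (hne z hz)) (half_pos hε)
  obtain ⟨M, hM⟩ := (isCompact_closedBall (0 : ℂ) r).exists_bound_of_continuousOn
    (f := fun z => q.eval z) (by fun_prop)
  have hM0 : 0 ≤ M := (norm_nonneg _).trans (hM 0 (by simpa using hr.le))
  obtain ⟨p, hp1, hp2⟩ := exists_polynomial_near_indicator hρ hρr hK hKs hKne
    (ε := ε / (2 * (M + 1))) (by positivity)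
  have hMε : M * (ε / (2 * (M + 1))) ≤ ε / 2 := by
    have : M * (ε / (2 * (M + 1))) = (M / (M + 1)) * (ε / 2) := by field_simp
    rw [this]
    have : M / (M + 1) ≤ 1 := (div_le_one (by positivity)).2 (by linarith)
    nlinarith
  have hpow : ∀ z : ℂ, ‖z‖ ≤ r → ‖z ^ N‖ ≤ 1 := fun z hz => by
    rw [norm_pow]
    exact pow_le_one₀ (norm_nonneg _) (hz.trans hr1)
  refine ⟨Polynomial.X ^ N * (q * p), fun k hk => ?_, fun z hz => ?_, fun z hz => ?_⟩
  · rw [Polynomial.coeff_X_pow_mul', if_neg (by omega)]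
  · have hzr : ‖z‖ ≤ r := (mem_closedBall_zero_iff.1 hz).trans hρr.le
    have h1 := hM z (mem_closedBall_zero_iff.2 hzr)
    simp only [Polynomial.eval_mul, Polynomial.eval_pow, Polynomial.eval_X, norm_mul]
    calc ‖z ^ N‖ * (‖q.eval z‖ * ‖p.eval z‖) ≤ 1 * (M * (ε / (2 * (M + 1)))) := by
          gcongr
          · exact hpow z hzr
          · exact hp1 z hz
      _ ≤ ε := by linarith
  · have hzr : ‖z‖ ≤ r := (hnorm z hz).le
    have h1 := hM z (mem_closedBall_zero_iff.2 hzr)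
    have hz0 := pow_ne_zero N (hne z hz)
    simp only [Polynomial.eval_mul, Polynomial.eval_pow, Polynomial.eval_X]
    have heq : z ^ N * (q.eval z * p.eval z) - g z =
        z ^ N * (q.eval z * (p.eval z - 1) + (q.eval z - g z / z ^ N)) := by
      field_simp
      ring
    rw [heq, norm_mul]
    calc ‖z ^ N‖ * ‖q.eval z * (p.eval z - 1) + (q.eval z - g z / z ^ N)‖
        ≤ 1 * (M * (ε / (2 * (M + 1))) + ε / 2) := by
          gcongr
          · exact hpow z hzr
          · refine (norm_add_le _ _).trans (add_le_add ?_ (hq z hz))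
            rw [norm_mul]
            gcongr
            exact hp2 z hz
      _ ≤ ε := by linarith

/-! ### Perturbations that make partial sums large -/

/-- Among the translates of `b` by multiples of `(2 n + 1) z ^ n`, one is large off a small set. -/
theorem exists_translate_measure_le {μ : Measure ℂ} [IsFiniteMeasure μ] (hμ : μ (ball 0 1) = 0)
    {b : ℂ → ℂ} (hb : Continuous b) (n : ℕ) :
    ∃ t : ℕ, t < (n + 1) ^ 2 ∧
      μ {z | ‖b z + (t * (2 * n + 1) : ℂ) * z ^ n‖ ≤ n} ≤ μ univ / ((n + 1) ^ 2 : ℕ) := by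
  by_contra! h
  set m := (n + 1) ^ 2 with hm
  have hm0 : m ≠ 0 := by positivity
  set s : ℕ → Set ℂ := fun t => {z | ‖b z + (t * (2 * n + 1) : ℂ) * z ^ n‖ ≤ n} \ ball 0 1
    with hs
  have hmeas : ∀ t, MeasurableSet (s t) := fun t =>
    (isClosed_le (by fun_prop) continuous_const).measurableSet.diff measurableSet_ball
  have hlt : μ univ < ∑ t ∈ Finset.range m, μ (s t) := by
    have h1 : μ univ = ∑ t ∈ Finset.range m, μ univ / (m : ℕ) := by
      rw [Finset.sum_const, Finset.card_range, nsmul_eq_mul,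
        ENNReal.mul_div_cancel (by exact_mod_cast hm0) (ENNReal.natCast_ne_top m)]
    rw [h1]
    refine ENNReal.sum_lt_sum_of_nonempty ⟨0, by simpa using Nat.pos_of_ne_zero hm0⟩ ?_
    intro t ht
    rw [hs]
    simp only
    rw [measure_sdiff_null hμ]
    exact h t (Finset.mem_range.1 ht)
  -- Pigeonhole: two bad sets share a point with `1 ≤ ‖z‖`, where the two values differ by at least
  -- `2 * n + 1` yet both have norm at most `n`.
  obtain ⟨i, -, j, -, hij, z, hzi, hzj⟩ :=
    exists_nonempty_inter_of_measure_univ_lt_sum_measure μ (s := Finset.range m) (t := s)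
      (fun t _ => (hmeas t).nullMeasurableSet) hlt
  have h1 : ‖b z + (i * (2 * n + 1) : ℂ) * z ^ n‖ ≤ n := hzi.1
  have h2 : ‖b z + (j * (2 * n + 1) : ℂ) * z ^ n‖ ≤ n := hzj.1
  have hz : 1 ≤ ‖z‖ := by simpa using hzi.2
  have h3 := (norm_sub_le _ _).trans (add_le_add h1 h2)
  have h4 : (b z + (i * (2 * n + 1) : ℂ) * z ^ n) - (b z + (j * (2 * n + 1) : ℂ) * z ^ n) =
      (((i : ℤ) - (j : ℤ) : ℤ) : ℂ) * ((2 * n + 1 : ℕ) : ℂ) * z ^ n := by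
    push_cast; ring
  rw [h4, norm_mul, norm_mul, norm_pow, Complex.norm_natCast, Complex.norm_intCast] at h3
  have h5 : (1 : ℝ) ≤ |(((i : ℤ) - (j : ℤ) : ℤ) : ℝ)| := by
    have : (1 : ℤ) ≤ |(i : ℤ) - j| := Int.one_le_abs (by omega)
    exact_mod_cast this
  have h6 : (1 : ℝ) ≤ ‖z‖ ^ n := one_le_pow₀ hz
  have h7 : (1 : ℝ) * ((2 * n + 1 : ℕ) : ℝ) * 1 ≤
      |(((i : ℤ) - (j : ℤ) : ℤ) : ℝ)| * ((2 * n + 1 : ℕ) : ℝ) * ‖z‖ ^ n := by gcongr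
  push_cast at h7 h3
  linarith

/-- The polynomial partial sums. -/
noncomputable def Polynomial.partialSum (p : Polynomial ℂ) (n : ℕ) (z : ℂ) : ℂ :=
  ∑ k ∈ Finset.range (n + 1), p.coeff k * z ^ k

theorem Polynomial.partialSum_congr {p q : Polynomial ℂ} {n : ℕ}
    (h : ∀ k ≤ n, p.coeff k = q.coeff k) : p.partialSum n = q.partialSum n := by
  funext z
  refine Finset.sum_congr rfl fun k hk => ?_
  rw [h k (Nat.lt_succ_iff.1 (Finset.mem_range.1 hk))]

/-- Polynomials whose coefficients have at most cubic growth and vanish below `N`. -/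
structure IsSlowPerturbation (q : Polynomial ℂ) (N : ℕ) : Prop where
  coeff_eq_zero : ∀ k < N, q.coeff k = 0
  norm_coeff_le : ∀ k, ‖q.coeff k‖ ≤ ((k : ℝ) + 1) ^ 2 * (2 * k + 1)

/-- Coefficients are chosen one degree at a time: the one of degree `n` leaves earlier partial sums
alone, and `t < (n + 1) ^ 2` gives the cubic bound. -/
theorem exists_slowPerturbation {μ : Measure ℂ} [IsFiniteMeasure μ] (hμ : μ (ball 0 1) = 0)
    (a : Polynomial ℂ) (N N' : ℕ) :
    ∃ q : Polynomial ℂ, IsSlowPerturbation q N ∧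
      ∀ n, N ≤ n → n < N' →
        μ {z | ‖(a + q).partialSum n z‖ ≤ n} ≤ μ univ / ((n + 1) ^ 2 : ℕ) := by
  -- Vanishing from degree `N'` on is carried along so that the next monomial fills an empty slot.
  suffices H : ∃ q : Polynomial ℂ, IsSlowPerturbation q N ∧ (∀ k ≥ N', q.coeff k = 0) ∧
      ∀ n, N ≤ n → n < N' →
        μ {z | ‖(a + q).partialSum n z‖ ≤ n} ≤ μ univ / ((n + 1) ^ 2 : ℕ) by
    obtain ⟨q, h1, -, h2⟩ := H
    exact ⟨q, h1, h2⟩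
  induction N' with
  | zero =>
    exact ⟨0, ⟨by simp, fun k => by simp; positivity⟩, by simp, fun n _ h => by omega⟩
  | succ M ih =>
    obtain ⟨q, hq, hqM, hqn⟩ := ih
    rcases lt_or_ge M N with hMN | hMN
    · exact ⟨q, hq, fun k hk => hqM k (by omega), fun n h1 h2 => by omega⟩
    obtain ⟨t, ht, htμ⟩ := exists_translate_measure_le hμ
      (b := (a + q).partialSum M) (by unfold Polynomial.partialSum; fun_prop) M
    set c : ℂ := t * (2 * M + 1) with hc
    have hcoeff : ∀ k, k ≠ M → (q + Polynomial.monomial M c).coeff k = q.coeff k := fun k hk => by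
      rw [Polynomial.coeff_add, Polynomial.coeff_monomial_of_ne _ hk, add_zero]
    have hcoeffM : (q + Polynomial.monomial M c).coeff M = c := by
      rw [Polynomial.coeff_add, Polynomial.coeff_monomial_same, hqM M le_rfl, zero_add]
    refine ⟨q + Polynomial.monomial M c, ⟨fun k hk => ?_, fun k => ?_⟩, fun k hk => ?_,
      fun n hNn hn => ?_⟩
    · rw [hcoeff k (by omega)]
      exact hq.coeff_eq_zero k hk
    · rcases eq_or_ne k M with rfl | hk
      · rw [hcoeffM, hc, show (2 * k + 1 : ℂ) = ((2 * k + 1 : ℕ) : ℂ) by push_cast; rfl,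
          norm_mul, Complex.norm_natCast, Complex.norm_natCast]
        have : (t : ℝ) ≤ ((k : ℝ) + 1) ^ 2 := by exact_mod_cast ht.le
        push_cast
        gcongr
      · rw [hcoeff k hk]
        exact hq.norm_coeff_le k
    · rw [hcoeff k (by omega)]
      exact hqM k (by omega)
    · rcases eq_or_ne n M with rfl | hnM
      · have : ∀ z, (a + (q + Polynomial.monomial n c)).partialSum n z =
            (a + q).partialSum n z + c * z ^ n := fun z => by
          unfold Polynomial.partialSum
          rw [← add_assoc]
          simp only [Polynomial.coeff_add (a + q), add_mul, Finset.sum_add_distrib]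
          congr 1
          rw [Finset.sum_eq_single n]
          · rw [Polynomial.coeff_monomial_same]
          · intro k _ hk
            rw [Polynomial.coeff_monomial_of_ne _ hk, zero_mul]
          · simp
        simp only [this]
        exact htμ
      · rw [Polynomial.partialSum_congr (q := a + q)]
        · exact hqn n hNn (by omega)
        · intro k hk
          rw [Polynomial.coeff_add, hcoeff k (by omega), Polynomial.coeff_add]

/-- Slow perturbations starting at `N` are at most `ε` on the disc of radius `r`. -/
def SlowTailLE (r ε : ℝ) (N : ℕ) : Prop :=
  ∀ q, IsSlowPerturbation q N → ∀ z ∈ closedBall (0 : ℂ) r, ‖q.eval z‖ ≤ ε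

/-- Cubic growth is summable against `r ^ k`. The threshold is uniform in `q`, so it can be fixed
before the perturbation is chosen. -/
theorem exists_slowTailLE {r ε : ℝ} (hr0 : 0 ≤ r) (hr : r < 1) (hε : 0 < ε) :
    ∃ N₀, ∀ N ≥ N₀, SlowTailLE r ε N := by
  have hsum : Summable fun k : ℕ => ((k : ℝ) + 1) ^ 2 * (2 * k + 1) * r ^ k := by
    have h (d : ℕ) := summable_pow_mul_geometric_of_norm_lt_one d
      (r := r) (by rwa [Real.norm_of_nonneg hr0])
    refine ((((h 3).mul_left 2).add ((h 2).mul_left 5)).add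
      (((h 1).mul_left 4).add (h 0))).congr fun k => ?_
    ring
  obtain ⟨s, hs⟩ := summable_iff_vanishing_norm.1 hsum ε hε
  refine ⟨s.sup id + 1, fun N hN q hq z hz => ?_⟩
  have hdisj : Disjoint q.support s := by
    rw [Finset.disjoint_left]
    intro k hk hks
    have : k ≤ s.sup id := Finset.le_sup (f := id) hks
    exact (Polynomial.mem_support_iff.1 hk) (hq.coeff_eq_zero k (by omega))
  have h1 := (le_abs_self _).trans (hs _ hdisj).le
  rw [Polynomial.eval_eq_sum, Polynomial.sum]
  refine (norm_sum_le_of_le _ fun k _ => ?_).trans h1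
  rw [norm_mul, norm_pow]
  gcongr
  · exact hq.norm_coeff_le k
  · exact mem_closedBall_zero_iff.1 hz

theorem SlowTailLE.mono {r r' ε : ℝ} {N : ℕ} (h : SlowTailLE r ε N) (hr : r' ≤ r) :
    SlowTailLE r' ε N :=
  fun q hq z hz => h q hq z (closedBall_subset_closedBall hr hz)

/-! ### The inductive construction -/

/-- One step of the construction. -/
theorem exists_extension {μ : Measure ℂ} [IsFiniteMeasure μ] (hμ : μ (ball 0 1) = 0)
    {ρ r r' ε ε' : ℝ} (hρ : 0 ≤ ρ) (hρr : ρ < r) (hr1 : r ≤ 1) (hr'0 : 0 ≤ r') (hr' : r' < 1)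
    (hε : 0 < ε) (hε' : 0 < ε') {K : Set ℂ} (hK : IsCompact K) (hKs : K ⊆ sphere 0 1)
    (hKne : K ≠ sphere 0 1) (φ : C(ℂ, ℂ)) (F : Polynomial ℂ) (N : ℕ) (hN : SlowTailLE r (ε / 2) N) :
    ∃ (F' : Polynomial ℂ) (N' : ℕ), N < N' ∧ SlowTailLE r' (ε' / 2) N' ∧
      (∀ k < N, F'.coeff k = F.coeff k) ∧
      (∀ z ∈ closedBall (0 : ℂ) ρ, ‖F'.eval z - F.eval z‖ ≤ ε) ∧
      (∀ z ∈ K, ‖F'.eval (r * z) - φ z‖ ≤ ε) ∧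
      ∀ n, N ≤ n → n < N' →
        μ {z | ‖F'.partialSum n z‖ ≤ n} ≤ μ univ / ((n + 1) ^ 2 : ℕ) := by
  have hr : 0 < r := hρ.trans_lt hρr
  have hrc : (r : ℂ) ≠ 0 := by exact_mod_cast hr.ne'
  have hnorm : ∀ z : ℂ, ‖(r : ℂ) * z‖ = r * ‖z‖ := fun z => by
    rw [norm_mul, Complex.norm_real, Real.norm_of_nonneg hr.le]
  obtain ⟨P, hP0, hPρ, hPK⟩ := exists_polynomial_near_zero_and_near
    (K := (fun z => (r : ℂ) * z) '' K) (g := fun z => φ (z / r) - F.eval z) hρ hρr hr1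
    (hK.image (by fun_prop))
    (by
      rintro _ ⟨z, hz, rfl⟩
      have := mem_sphere_zero_iff_norm.1 (hKs hz)
      rw [mem_sphere_zero_iff_norm, hnorm, this, mul_one])
    (by
      intro h
      refine hKne (hKs.antisymm fun z hz => ?_)
      have : (r : ℂ) * z ∈ sphere (0 : ℂ) r := by
        rw [mem_sphere_zero_iff_norm, hnorm, mem_sphere_zero_iff_norm.1 hz, mul_one]
      rw [← h] at this
      obtain ⟨w, hw, hwz⟩ := this
      rwa [← mul_left_cancel₀ hrc hwz])
    (Continuous.continuousOn (by fun_prop)) N (half_pos hε)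
  obtain ⟨N₀, hN₀⟩ := exists_slowTailLE hr'0 hr' (half_pos hε')
  -- Perturbing up to `N₀` prepares the next stage's tail bound; `N + 1` forces strict growth of the
  -- cutoffs.
  obtain ⟨q, hq, hqμ⟩ := exists_slowPerturbation hμ (F + P) N (max N₀ (N + 1))
  refine ⟨F + P + q, max N₀ (N + 1), lt_of_lt_of_le (Nat.lt_succ_self N) (le_max_right _ _),
    hN₀ _ (le_max_left _ _), fun k hk => ?_, fun z hz => ?_, fun z hz => ?_, hqμ⟩
  · simp [hP0 k hk, hq.coeff_eq_zero k hk]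
  · have h1 := hPρ z hz
    have h2 := (hN.mono hρr.le) q hq z hz
    have h3 : (F + P + q).eval z - F.eval z = P.eval z + q.eval z := by simp; ring
    rw [h3]
    exact (norm_add_le _ _).trans (by linarith)
  · have h1 := hPK _ (mem_image_of_mem _ hz)
    have h2 := hN q hq (r * z) (by
      rw [mem_closedBall_zero_iff, hnorm, mem_sphere_zero_iff_norm.1 (hKs hz), mul_one])
    simp only [mul_div_cancel_left₀ z hrc] at h1
    have h3 : (F + P + q).eval (r * z) - φ z =
        (P.eval (r * z) - (φ z - F.eval (r * z))) + q.eval (r * z) := by simp; ring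
    rw [h3]
    exact (norm_add_le _ _).trans (by linarith)

/-- The radii `1 - 1 / (j + 2)`. -/
noncomputable def stageRadius (j : ℕ) : ℝ := 1 - 1 / ((j : ℝ) + 2)

theorem stageRadius_nonneg (j : ℕ) : 0 ≤ stageRadius j := by
  have : 1 / ((j : ℝ) + 2) ≤ 1 := (div_le_one (by positivity)).2 (by linarith [j.cast_nonneg (α := ℝ)])
  unfold stageRadius
  linarith

theorem stageRadius_lt_one (j : ℕ) : stageRadius j < 1 := by
  have : 0 < 1 / ((j : ℝ) + 2) := by positivity
  unfold stageRadius
  linarith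

theorem stageRadius_strictMono : StrictMono stageRadius := by
  refine strictMono_nat_of_lt_succ fun j => ?_
  unfold stageRadius
  push_cast
  gcongr
  linarith

theorem tendsto_stageRadius : Tendsto stageRadius atTop (𝓝 1) := by
  have h : Tendsto (fun j : ℕ => 1 / ((j : ℝ) + 2)) atTop (𝓝 0) := by
    simpa [Function.comp_def] using
      (tendsto_const_div_atTop_nhds_zero_nat (1 : ℝ)).comp (tendsto_add_atTop_nat 2)
  have h1 := h.const_sub 1
  rwa [sub_zero] at h1

/-- A sequence of polynomials stabilising coefficientwise, converging on the disc, approximating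
prescribed functions near the circle and with large partial sums off small sets. -/
structure IsUniversalSequence (μ : Measure ℂ) (K : ℕ → Set ℂ) (φ : ℕ → C(ℂ, ℂ))
    (F : ℕ → Polynomial ℂ) (N : ℕ → ℕ) : Prop where
  strictMono : StrictMono N
  coeff_succ : ∀ j k, k < N j → (F (j + 1)).coeff k = (F j).coeff k
  norm_sub_le : ∀ j, ∀ z ∈ closedBall (0 : ℂ) (stageRadius j),
    ‖(F (j + 1)).eval z - (F j).eval z‖ ≤ (1 / 2) ^ j
  near : ∀ j, ∀ z ∈ K j, ‖(F (j + 1)).eval (stageRadius (j + 1) * z) - φ j z‖ ≤ (1 / 2) ^ j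
  measure_le : ∀ j n, N j ≤ n → n < N (j + 1) →
    μ {z | ‖(F (j + 1)).partialSum n z‖ ≤ n} ≤ μ univ / ((n + 1) ^ 2 : ℕ)

theorem exists_isUniversalSequence {μ : Measure ℂ} [IsFiniteMeasure μ] (hμ : μ (ball 0 1) = 0)
    {K : ℕ → Set ℂ} (hK : ∀ j, IsCompact (K j)) (hKs : ∀ j, K j ⊆ sphere 0 1)
    (hKne : ∀ j, K j ≠ sphere 0 1) (φ : ℕ → C(ℂ, ℂ)) :
    ∃ F N, IsUniversalSequence μ K φ F N := by
  have hpos : ∀ j : ℕ, (0 : ℝ) < (1 / 2) ^ j := fun j => by positivity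
  have step := fun j F N => exists_extension hμ (stageRadius_nonneg j)
    (stageRadius_strictMono (Nat.lt_succ_self j)) (stageRadius_lt_one _).le
    (stageRadius_nonneg (j + 2)) (stageRadius_lt_one (j + 2)) (hpos j) (hpos (j + 1))
    (hK j) (hKs j) (hKne j) (φ j) F N
  choose F' N' h1 h2 h3 h4 h5 h6 using step
  obtain ⟨N₀, hN₀⟩ := exists_slowTailLE (stageRadius_nonneg 1) (stageRadius_lt_one 1)
    (half_pos (hpos 0))
  -- The tail bound for the coming stage is part of the state, since `exists_extension` needs it as
  -- input.
  let S : ∀ j : ℕ, {x : Polynomial ℂ × ℕ //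
      SlowTailLE (stageRadius (j + 1)) ((1 / 2) ^ j / 2) x.2} := fun j =>
    Nat.rec ⟨(0, N₀), hN₀ N₀ le_rfl⟩
      (fun j s => ⟨(F' j s.1.1 s.1.2 s.2, N' j s.1.1 s.1.2 s.2), h2 j s.1.1 s.1.2 s.2⟩) j
  exact ⟨fun j => (S j).1.1, fun j => (S j).1.2,
    strictMono_nat_of_lt_succ fun j => h1 j _ _ (S j).2, fun j => h3 j _ _ (S j).2,
    fun j => h4 j _ _ (S j).2, fun j => h5 j _ _ (S j).2, fun j => h6 j _ _ (S j).2⟩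

/-! ### The limit function and its Taylor coefficients -/

theorem Polynomial.iteratedDeriv_eval_zero_div_factorial (p : Polynomial ℂ) (k : ℕ) :
    iteratedDeriv k (fun z => p.eval z) 0 / (k.factorial : ℂ) = p.coeff k := by
  have h : ∀ k : ℕ, iteratedDeriv k (fun z => p.eval z) =
      fun z => (Polynomial.derivative^[k] p).eval z := by
    intro k
    induction k with
    | zero => simp
    | succ k ih =>
      funext z
      rw [iteratedDeriv_succ, ih, Function.iterate_succ_apply', Polynomial.deriv]
  simp only [h]
  rw [← Polynomial.coeff_zero_eq_eval_zero, Polynomial.coeff_iterate_derivative, zero_add,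
    Nat.descFactorial_self, nsmul_eq_mul,
    mul_div_cancel_left₀ _ (by exact_mod_cast k.factorial_ne_zero)]

theorem tendstoLocallyUniformlyOn_iteratedDeriv {F : ℕ → ℂ → ℂ} {f : ℂ → ℂ} {U : Set ℂ}
    (hU : IsOpen U) (hF : ∀ j, Differentiable ℂ (F j))
    (h : TendstoLocallyUniformlyOn F f atTop U) (k : ℕ) :
    TendstoLocallyUniformlyOn (fun j => iteratedDeriv k (F j)) (iteratedDeriv k f) atTop U := by
  induction k with
  | zero => simpa using h
  | succ k ih =>
    simp only [iteratedDeriv_succ]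
    exact ih.deriv (Eventually.of_forall fun j => ((hF j).contDiff.differentiable_iteratedDeriv k
      (by exact_mod_cast WithTop.coe_lt_top _)).differentiableOn) hU

namespace IsUniversalSequence

variable {μ : Measure ℂ} {K : ℕ → Set ℂ} {φ : ℕ → C(ℂ, ℂ)} {F : ℕ → Polynomial ℂ} {N : ℕ → ℕ}

theorem coeff_eq (h : IsUniversalSequence μ K φ F N) {i j k : ℕ} (hij : i ≤ j) (hk : k < N i) :
    (F j).coeff k = (F i).coeff k := by
  induction j, hij using Nat.le_induction with
  | base => rfl
  | succ j hij ih => rw [h.coeff_succ j k (hk.trans_le (h.strictMono.monotone hij)), ih]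

theorem exists_limit (h : IsUniversalSequence μ K φ F N) :
    ∃ f : ℂ → ℂ, ∀ j, ∀ z ∈ closedBall (0 : ℂ) (stageRadius j),
      ‖(F j).eval z - f z‖ ≤ 2 * (1 / 2) ^ j := by
  have hdist : ∀ j, ∀ z ∈ closedBall (0 : ℂ) (stageRadius j), ∀ n,
      dist ((F (j + n)).eval z) ((F (j + (n + 1))).eval z) ≤ (1 / 2) ^ j * (1 / 2) ^ n := by
    intro j z hz n
    rw [dist_comm, dist_eq_norm, ← pow_add]
    exact h.norm_sub_le (j + n) z (closedBall_subset_closedBall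
      (stageRadius_strictMono.monotone (Nat.le_add_right j n)) hz)
  have hex : ∀ z : ℂ, ∃ w : ℂ, z ∈ ball (0 : ℂ) 1 →
      Tendsto (fun n => (F n).eval z) atTop (𝓝 w) := by
    intro z
    by_cases hz : z ∈ ball (0 : ℂ) 1
    · obtain ⟨j, hj⟩ := (tendsto_stageRadius.eventually_const_lt
        (mem_ball_zero_iff.1 hz)).exists
      obtain ⟨w, hw⟩ := cauchySeq_tendsto_of_complete (cauchySeq_of_le_geometric _ _ one_half_lt_one
        (hdist j z (mem_closedBall_zero_iff.2 hj.le)))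
      refine ⟨w, fun _ => (tendsto_add_atTop_iff_nat j).1 ?_⟩
      simpa [add_comm] using hw
    -- Off the disc the limit gets an arbitrary value.
    · exact ⟨0, fun h => absurd h hz⟩
  choose f hf using hex
  refine ⟨f, fun j z hz => ?_⟩
  have hz1 : z ∈ ball (0 : ℂ) 1 := closedBall_subset_ball (stageRadius_lt_one j) hz
  have h1 : Tendsto (fun n => (F (j + n)).eval z) atTop (𝓝 (f z)) := by
    simpa [add_comm] using (tendsto_add_atTop_iff_nat j).2 (hf z hz1)
  have h2 := dist_le_of_le_geometric_of_tendsto _ _ one_half_lt_one (hdist j z hz) h1 0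
  rw [dist_eq_norm] at h2
  refine h2.trans (le_of_eq ?_)
  norm_num
  ring

variable {f : ℂ → ℂ}

theorem tendstoLocallyUniformlyOn
    (hf : ∀ j, ∀ z ∈ closedBall (0 : ℂ) (stageRadius j), ‖(F j).eval z - f z‖ ≤ 2 * (1 / 2) ^ j) :
    TendstoLocallyUniformlyOn (fun j z => (F j).eval z) f atTop (ball 0 1) := by
  rw [Metric.tendstoLocallyUniformlyOn_iff]
  intro ε hε x hx
  obtain ⟨j, hj⟩ := (tendsto_stageRadius.eventually_const_lt (mem_ball_zero_iff.1 hx)).exists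
  refine ⟨ball 0 (stageRadius j), mem_nhdsWithin_of_mem_nhds
    (isOpen_ball.mem_nhds (mem_ball_zero_iff.2 hj)), ?_⟩
  have hlim : Tendsto (fun n : ℕ => 2 * (1 / 2 : ℝ) ^ n) atTop (𝓝 0) := by
    simpa using (tendsto_pow_atTop_nhds_zero_of_lt_one (by norm_num : (0 : ℝ) ≤ 1 / 2)
      one_half_lt_one).const_mul 2
  filter_upwards [hlim.eventually_lt_const hε, eventually_ge_atTop j] with n hn hjn z hz
  rw [dist_comm, dist_eq_norm]
  exact (hf n z (closedBall_subset_closedBall (stageRadius_strictMono.monotone hjn)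
    (ball_subset_closedBall hz))).trans_lt hn

theorem differentiableOn_limit
    (hf : ∀ j, ∀ z ∈ closedBall (0 : ℂ) (stageRadius j), ‖(F j).eval z - f z‖ ≤ 2 * (1 / 2) ^ j) :
    DifferentiableOn ℂ f (ball 0 1) :=
  (tendstoLocallyUniformlyOn hf).differentiableOn
    (Eventually.of_forall fun j => (F j).differentiable.differentiableOn) isOpen_ball

/-- Locally uniform convergence passes to derivatives at 0, and the coefficients below `N j` no
longer change after stage `j`. -/
theorem taylorPartialSum_limit (h : IsUniversalSequence μ K φ F N)
    (hf : ∀ j, ∀ z ∈ closedBall (0 : ℂ) (stageRadius j), ‖(F j).eval z - f z‖ ≤ 2 * (1 / 2) ^ j)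
    {j n : ℕ} (hn : n < N j) : taylorPartialSum f n = (F j).partialSum n := by
  funext z
  refine Finset.sum_congr rfl fun k hk => ?_
  have hkN : k < N j := (Nat.lt_succ_iff.1 (Finset.mem_range.1 hk)).trans_lt hn
  congr 1
  have h1 := ((tendstoLocallyUniformlyOn_iteratedDeriv isOpen_ball
    (fun j => (F j).differentiable) (tendstoLocallyUniformlyOn hf) k).tendsto_at
    (mem_ball_self zero_lt_one)).div_const (k.factorial : ℂ)
  simp only [Polynomial.iteratedDeriv_eval_zero_div_factorial] at h1
  refine tendsto_nhds_unique h1 (tendsto_const_nhds.congr' ?_)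
  filter_upwards [eventually_ge_atTop j] with i hi
  exact (h.coeff_eq hi hkN).symm

/-- Borel–Cantelli: the blocks from `N j` to `N (j + 1)` cover every `n ≥ N 0`, and the measures of
the bad sets are summable. -/
theorem ae_tendsto_taylorPartialSum [IsFiniteMeasure μ] (h : IsUniversalSequence μ K φ F N)
    (hf : ∀ j, ∀ z ∈ closedBall (0 : ℂ) (stageRadius j), ‖(F j).eval z - f z‖ ≤ 2 * (1 / 2) ^ j) :
    ∀ᵐ z ∂μ, Tendsto (fun n : ℕ => ‖taylorPartialSum f n z‖) atTop atTop := by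
  have hbound : ∀ n, N 0 ≤ n →
      μ {z | ‖taylorPartialSum f n z‖ ≤ n} ≤ μ univ / ((n + 1) ^ 2 : ℕ) := by
    intro n hn
    have hex : ∃ j, n < N j := ⟨n + 1, (Nat.lt_succ_self n).trans_le h.strictMono.le_apply⟩
    classical
    obtain ⟨j, hj⟩ : ∃ j, Nat.find hex = j + 1 :=
      Nat.exists_eq_succ_of_ne_zero fun h0 => by
        have := Nat.find_spec hex
        rw [h0] at this
        omega
    have hlt := Nat.find_spec hex
    rw [hj] at hlt
    have hge : N j ≤ n := not_lt.1 (Nat.find_min hex (by omega))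
    rw [h.taylorPartialSum_limit hf hlt]
    exact h.measure_le j n hge hlt
  have hsum : ∑' n : ℕ, μ {z | N 0 ≤ n ∧ ‖taylorPartialSum f n z‖ ≤ n} ≠ ⊤ := by
    have hle : ∀ n : ℕ, μ {z | N 0 ≤ n ∧ ‖taylorPartialSum f n z‖ ≤ n} ≤
        μ univ * ENNReal.ofReal (1 / ((n : ℝ) + 1) ^ 2) := by
      intro n
      by_cases hn : N 0 ≤ n
      · simp only [hn, true_and]
        refine (hbound n hn).trans (le_of_eq ?_)
        rw [div_eq_mul_inv, one_div, ENNReal.ofReal_inv_of_pos (by positivity)]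
        congr 2
        rw [← ENNReal.ofReal_natCast]
        push_cast
        rfl
      · simp [hn]
    refine ne_top_of_le_ne_top ?_ (ENNReal.tsum_le_tsum hle)
    rw [ENNReal.tsum_mul_left]
    refine ENNReal.mul_ne_top (measure_ne_top _ _) ?_
    have : Summable fun n : ℕ => 1 / ((n : ℝ) + 1) ^ 2 := by
      simpa using (summable_nat_add_iff 1).2 (Real.summable_one_div_nat_pow.2 one_lt_two)
    exact this.tsum_ofReal_ne_top
  filter_upwards [ae_eventually_notMem hsum] with z hz
  refine tendsto_atTop_mono' _ ?_ tendsto_natCast_atTop_atTop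
  filter_upwards [hz, eventually_ge_atTop (N 0)] with n hn hn0
  by_contra hlt
  exact hn ⟨hn0, (not_le.1 hlt).le⟩

end IsUniversalSequence

/-! ### Countable test families and conclusion -/

/-- A proper compact subset misses a neighbourhood of some point, hence a ball of radius `1 / (n +
1)` about a point of a countable dense set. -/
theorem exists_exhausting_arcs :
    ∃ A : ℕ → Set ℂ, (∀ i, IsCompact (A i) ∧ A i ⊆ sphere 0 1 ∧ A i ≠ sphere 0 1) ∧
      ∀ K : Set ℂ, IsCompact K → K ⊆ sphere 0 1 → K ≠ sphere 0 1 → ∃ i, K ⊆ A i := by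
  have : Nonempty (sphere (0 : ℂ) 1) := ⟨⟨1, by simp⟩⟩
  set ζ := TopologicalSpace.denseSeq (sphere (0 : ℂ) 1)
  refine ⟨fun i => sphere 0 1 \ ball (ζ i.unpair.1 : ℂ) (1 / ((i.unpair.2 : ℝ) + 1)),
    fun i => ⟨(isCompact_sphere _ _).diff isOpen_ball, sdiff_subset, fun h => ?_⟩,
    fun K hK hKs hKne => ?_⟩
  · have h1 := (ζ i.unpair.1).2
    exact (h.symm.subset h1).2 (mem_ball_self (by positivity))
  · obtain ⟨ξ, hξ, hξK⟩ : ∃ ξ ∈ sphere (0 : ℂ) 1, ξ ∉ K := by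
      by_contra! h
      exact hKne (hKs.antisymm h)
    obtain ⟨δ, hδ, hδK⟩ := Metric.isOpen_iff.1 hK.isClosed.isOpen_compl ξ hξK
    obtain ⟨n, hn⟩ := exists_nat_one_div_lt (half_pos hδ)
    obtain ⟨m, hm⟩ := (TopologicalSpace.denseRange_denseSeq (sphere (0 : ℂ) 1)).exists_dist_lt
      ⟨ξ, hξ⟩ (half_pos hδ)
    refine ⟨Nat.pair m n, fun z hz => ⟨hKs hz, fun hzb => ?_⟩⟩
    simp only [Nat.unpair_pair, mem_ball] at hzb
    refine hδK (mem_ball.2 ?_) hz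
    have hm' : dist (ζ m : ℂ) ξ < δ / 2 := by
      rw [dist_comm]
      exact hm
    linarith [dist_triangle z (ζ m) ξ]

/-- `C(ℂ, ℂ)` is separable for uniform convergence on compact sets, and Tietze extends `g` from `K`
to the plane. -/
theorem exists_approximating_sequence :
    ∃ φ : ℕ → C(ℂ, ℂ), ∀ K : Set ℂ, IsCompact K → ∀ g : ℂ → ℂ, ContinuousOn g K →
      ∀ ε > 0, ∃ l, ∀ z ∈ K, ‖φ l z - g z‖ < ε := by
  refine ⟨TopologicalSpace.denseSeq C(ℂ, ℂ), fun K hK g hg ε hε => ?_⟩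
  obtain ⟨G, hG⟩ := ContinuousMap.exists_restrict_eq hK.isClosed ⟨K.domRestrict g, hg.domRestrict⟩
  have hd := (TopologicalSpace.denseRange_denseSeq C(ℂ, ℂ)) G
  obtain ⟨x, hx, hlim⟩ := mem_closure_iff_seq_limit.1 hd
  obtain ⟨n, hn⟩ := (Metric.tendstoUniformlyOn_iff.1
    (ContinuousMap.tendsto_iff_forall_isCompact_tendstoUniformlyOn.1 hlim K hK) ε hε).exists
  obtain ⟨l, hl⟩ := hx n
  refine ⟨l, fun z hz => ?_⟩
  have h1 : G z = g z := congrArg (fun a : C(K, ℂ) => a ⟨z, hz⟩) hG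
  rw [← h1, ← dist_eq_norm, dist_comm, hl]
  exact hn z hz

/-- For every finite measure not charging the disc there is an Abel universal function whose
Taylor partial sums tend to infinity almost everywhere. -/
theorem exists_isAbelUniversal_ae_tendsto (μ : Measure ℂ) [IsFiniteMeasure μ]
    (hμ : μ (ball 0 1) = 0) :
    ∃ f : ℂ → ℂ, IsAbelUniversal f ∧
      ∀ᵐ z ∂μ, Tendsto (fun n : ℕ => ‖taylorPartialSum f n z‖) atTop atTop := by
  obtain ⟨A, hA, hAK⟩ := exists_exhausting_arcs
  obtain ⟨φ, hφ⟩ := exists_approximating_sequence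
  obtain ⟨F, N, h⟩ := exists_isUniversalSequence hμ (K := fun j => A j.unpair.1.unpair.1)
    (fun j => (hA _).1) (fun j => (hA _).2.1) (fun j => (hA _).2.2)
    (fun j => φ j.unpair.1.unpair.2)
  obtain ⟨f, hf⟩ := h.exists_limit
  refine ⟨f, ⟨IsUniversalSequence.differentiableOn_limit hf, fun K hK hKs hKne g hg => ?_⟩,
    h.ae_tendsto_taylorPartialSum hf⟩
  obtain ⟨i, hi⟩ := hAK K hK hKs hKne
  choose l hl using fun n : ℕ => hφ K hK g hg (1 / ((n : ℝ) + 1)) (by positivity)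
  -- The extra coordinate `n` repeats each pair of arc and function infinitely often, so arbitrarily
  -- late stages are available.
  set J : ℕ → ℕ := fun n => Nat.pair (Nat.pair i (l n)) n with hJ
  have hnJ : ∀ n, n ≤ J n := fun n => Nat.right_le_pair _ _
  refine ⟨fun n => stageRadius (J n + 1), fun n => ⟨stageRadius_nonneg _, stageRadius_lt_one _⟩,
    tendsto_stageRadius.comp (tendsto_atTop_mono (fun n => (hnJ n).trans (Nat.le_succ _))
      tendsto_id), ?_⟩
  have hlim : Tendsto (fun n : ℕ => 2 * (1 / 2 : ℝ) ^ n + 1 / ((n : ℝ) + 1)) atTop (𝓝 0) := by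
    simpa using ((tendsto_pow_atTop_nhds_zero_of_lt_one (by norm_num : (0 : ℝ) ≤ 1 / 2)
      one_half_lt_one).const_mul 2).add tendsto_one_div_add_atTop_nhds_zero_nat
  rw [Metric.tendstoUniformlyOn_iff]
  intro ε hε
  filter_upwards [hlim.eventually_lt_const hε] with n hn z hz
  refine lt_of_le_of_lt ?_ hn
  set w : ℂ := (stageRadius (J n + 1) : ℂ) * z with hw
  have hwmem : w ∈ closedBall (0 : ℂ) (stageRadius (J n + 1)) := by
    rw [mem_closedBall_zero_iff, hw, norm_mul, Complex.norm_real,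
      Real.norm_of_nonneg (stageRadius_nonneg _), mem_sphere_zero_iff_norm.1 (hKs hz), mul_one]
  have h1 := hf (J n + 1) w hwmem
  have h2 := h.near (J n) z (by simpa [hJ] using hi hz)
  simp only [hJ, Nat.unpair_pair] at h2
  have h3 := (hl n z hz).le
  have h4 : (1 / 2 : ℝ) ^ (J n) ≤ (1 / 2) ^ n :=
    pow_le_pow_of_le_one (by norm_num) (by norm_num) (hnJ n)
  rw [pow_succ] at h1
  have h5 : g z - f w = (((F (J n + 1)).eval w - f w) - ((F (J n + 1)).eval w - φ (l n) z)) -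
      (φ (l n) z - g z) := by ring
  rw [dist_eq_norm, h5]
  have h6 : ‖(F (J n + 1)).eval w - φ (l n) z‖ ≤ (1 / 2) ^ (J n) := h2
  refine (norm_sub_le _ _).trans ((add_le_add (norm_sub_le _ _) le_rfl).trans ?_)
  linarith

instance : IsFiniteMeasure arclengthMeasure := by
  unfold arclengthMeasure
  infer_instance

theorem arclengthMeasure_ball : arclengthMeasure (ball 0 1) = 0 := by
  have hm : Measurable fun θ : ℝ => Complex.exp (θ * Complex.I) := by fun_prop
  rw [arclengthMeasure, Measure.map_apply hm measurableSet_ball]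
  have : (fun θ : ℝ => Complex.exp (θ * Complex.I)) ⁻¹' ball 0 1 = ∅ := by
    ext θ
    simp [Complex.norm_exp_ofReal_mul_I]
  rw [this, measure_empty]

theorem corollary4p10 :
    ∃ f : ℂ → ℂ, IsAbelUniversal f ∧
      (∀ᵐ z ∂((volume : Measure ℂ).restrict (closedBall (0 : ℂ) 1)ᶜ),
        Tendsto (fun n : ℕ => ‖taylorPartialSum f n z‖) atTop atTop) ∧
      (∀ᵐ z ∂arclengthMeasure,
        Tendsto (fun n : ℕ => ‖taylorPartialSum f n z‖) atTop atTop) := by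
  -- Area outside the disc is infinite, so it is replaced by a finite measure with the same null
  -- sets; adding arclength makes one `f` serve both claims.
  set ν := (volume : Measure ℂ).restrict (closedBall (0 : ℂ) 1)ᶜ with hν
  have hball : (ν.toFinite + arclengthMeasure) (ball 0 1) = 0 := by
    rw [Measure.add_apply, arclengthMeasure_ball, add_zero]
    apply toFinite_absolutelyContinuous
    rw [hν, Measure.restrict_apply measurableSet_ball,
      (disjoint_compl_right.mono_left ball_subset_closedBall).inter_eq, measure_empty]
  obtain ⟨f, hf, hae⟩ := exists_isAbelUniversal_ae_tendsto (ν.toFinite + arclengthMeasure) hball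
  rw [ae_add_measure_iff] at hae
  exact ⟨f, hf, (absolutelyContinuous_toFinite ν).ae_le hae.1, hae.2⟩
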